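/- Let $\mathscr{H}$ be a complex Hilbert space and let $T$ be a bounded linear operator on $\mathscr{H}$, with adjoint $T^*$ and numerical radius $w(T)=\sup\{|\langle Tx,x\rangle| : x\in\mathscr{H},\ \|x\|=1\}$ (equal to $0$ if $\mathscr{H}=\{0\}$). Then, for every real number $r$ with $1\le r\le 2$, $$w^2(T)\ \le\ \left\|\int_0^1\big(tT^*T+(1-t)TT^*\big)^r\,dt\right\|^{1/r}\ \le\ \left\|\frac{(T^*T)^r+(TT^*)^r}{2}\right\|^{1/r}.$$ Here $\|\cdot\|$ is the operator norm, the powers of positive operators are those of the continuous functional calculus, and the integral is the Bochner integral of an operator-valued function, which is Bochner integrable on $[0,1]$ with respect to the operator norm. -/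

import Mathlib

/-!
Put `a = T* T` and `b = T T*`. Cauchy–Schwarz bounds `|⟨T x, x⟩|` for a unit vector `x` by both
`‖T x‖` and `‖T* x‖`, whose squares are the quadratic forms of `a` and `b` at `x`; averaging gives
Kittaneh's inequality `w(T) ^ 2 ≤ ‖(a + b) / 2‖`. The rest is the Hermite–Hadamard inequality for
`c ↦ c ^ r`, which is operator convex for `1 ≤ r ≤ 2`: it places
`∫ (t a + (1 - t) b) ^ r dt` between `((a + b) / 2) ^ r` and `(a ^ r + b ^ r) / 2` in the operator
order, the norm is monotone on positive operators, and `‖c ^ r‖ = ‖c‖ ^ r` for positive `c`.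
-/

/-- The numerical radius `w(T) = sup {|⟨T x, x⟩| : ‖x‖ = 1}` of a bounded operator.
The set is bounded above (see `bddAbove_numericalRange_norm`); on the zero space it is
empty and `w(T) = 0`. Mathlib's inner product is conjugate-linear in its first slot, so the
usual `⟨T x, x⟩` (linear in the first slot) is written `inner ℂ x (T x)`. -/
noncomputable def numericalRadius {H : Type*} [NormedAddCommGroup H] [InnerProductSpace ℂ H]
    (T : H →L[ℂ] H) : ℝ :=
  sSup {a : ℝ | ∃ x : H, ‖x‖ = 1 ∧ a = ‖inner ℂ x (T x)‖}

theorem bddAbove_numericalRange_norm {H : Type*} [NormedAddCommGroup H]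
    [InnerProductSpace ℂ H] (T : H →L[ℂ] H) :
    BddAbove {a : ℝ | ∃ x : H, ‖x‖ = 1 ∧ a = ‖inner ℂ x (T x)‖} := by
  refine ⟨‖T‖, ?_⟩
  rintro a ⟨x, hx, rfl⟩
  calc ‖inner ℂ x (T x)‖ ≤ ‖x‖ * ‖T x‖ := norm_inner_le_norm x (T x)
    _ ≤ ‖T‖ := by
      have := T.le_opNorm x
      rw [hx, mul_one] at this
      rwa [hx, one_mul]

open MeasureTheory Set
open scoped NNReal

section OperatorConvexity

lemma convexOn_star_mul_self {A : Type*} [NonUnitalRing A] [StarRing A] [PartialOrder A]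
    [StarOrderedRing A] [Module ℝ A] [StarModule ℝ A] [IsScalarTower ℝ A A]
    [SMulCommClass ℝ A A] [PosSMulMono ℝ A] :
    ConvexOn ℝ univ (fun a : A ↦ star a * a) := by
  refine ⟨convex_univ, fun x _ y _ s t hs ht hst ↦ ?_⟩
  obtain rfl : t = 1 - s := by linarith
  have convexity_defect : s • (star x * x) + (1 - s) • (star y * y) -
      star (s • x + (1 - s) • y) * (s • x + (1 - s) • y) =
        (s * (1 - s)) • (star (x - y) * (x - y)) := by
    simp only [star_add, star_sub, star_smul, star_trivial, mul_add, add_mul, mul_sub, sub_mul,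
      smul_mul_assoc, mul_smul_comm]
    module
  rw [← sub_nonneg, convexity_defect]
  exact smul_nonneg (mul_nonneg hs ht) (star_mul_self_nonneg _)

lemma cfc_rpowIntegrand₁₂_eq {A : Type*} [CStarAlgebra A] [PartialOrder A] [StarOrderedRing A]
    {p t : ℝ} (ht : 0 < t) {a : A} (ha : 0 ≤ a) :
    cfc (Real.rpowIntegrand₁₂ p t) a =
      t ^ (p - 1) • (t⁻¹ • a + t • Ring.inverse (algebraMap ℝ A t + a) - 1) := by
  have hne : ∀ y ∈ spectrum ℝ a, t + y ≠ 0 := by grind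
  have hinv : ContinuousOn (fun y : ℝ ↦ (t + y)⁻¹) (spectrum ℝ a) :=
    ContinuousOn.inv₀ (by fun_prop) hne
  have hcont : ContinuousOn (fun y : ℝ ↦ t⁻¹ * y + t * (t + y)⁻¹) (spectrum ℝ a) := by fun_prop
  have hresolvent :
      cfc (fun y : ℝ ↦ (t + y)⁻¹) a = Ring.inverse (algebraMap ℝ A t + a) := by
    rw [cfc_inv (t + ·) a hne, cfc_const_add t (fun y ↦ y) a, cfc_id' ℝ a]
  have hsum : cfc (fun y : ℝ ↦ t⁻¹ * y + t * (t + y)⁻¹) a =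
      t⁻¹ • a + t • Ring.inverse (algebraMap ℝ A t + a) := by
    rw [cfc_add a (t⁻¹ * ·) (fun y ↦ t * (t + y)⁻¹) (by fun_prop) (hinv.const_mul t),
      cfc_const_mul_id t⁻¹ a, cfc_const_mul t _ a hinv, hresolvent]
  unfold Real.rpowIntegrand₁₂
  rw [cfc_const_mul _ _ a (hcont.fun_sub continuousOn_const), cfc_sub _ _ a hcont,
    cfc_const_one ℝ a, hsum]

lemma convexOn_cfc_rpowIntegrand₁₂ {A : Type*} [CStarAlgebra A] [PartialOrder A]
    [StarOrderedRing A] {p t : ℝ} (ht : 0 < t) :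
    ConvexOn ℝ (Ici (0 : A)) (cfc (Real.rpowIntegrand₁₂ p t)) := by
  refine ConvexOn.congr (ConvexOn.smul (by positivity) <| ConvexOn.sub (ConvexOn.add ?_ ?_) <|
    concaveOn_const 1 (convex_Ici 0)) fun a ha ↦ (cfc_rpowIntegrand₁₂_eq ht ha).symm
  · exact (convexOn_id (convex_Ici 0)).smul (inv_nonneg.2 ht.le)
  · exact (CStarAlgebra.convexOn_ringInverse_algebraMap_add ht).smul ht.le

section NonUnital

variable {A : Type*} [NonUnitalCStarAlgebra A] [PartialOrder A] [StarOrderedRing A]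

lemma convexOn_cfcₙ_rpowIntegrand₁₂ {p t : ℝ} (ht : 0 < t) :
    ConvexOn ℝ (Ici (0 : A)) (cfcₙ (Real.rpowIntegrand₁₂ p t)) := by
  refine CStarAlgebra.convexOn_cfcₙ_of_convexOn_cfc <|
    (convexOn_cfc_rpowIntegrand₁₂ ht).subset CStarAlgebra.inr_map_Ici_zero ?_
  exact (convex_Ici _).linear_image (Unitization.inrHom ℝ ℂ A)

lemma convexOn_nnrpow_Ioo_one_two {p : ℝ≥0} (hp : p ∈ Ioo 1 2) :
    ConvexOn ℝ (Ici (0 : A)) (fun a ↦ a ^ p) := by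
  obtain ⟨μ, hμ⟩ := CFC.exists_measure_nnrpow_eq_integral_cfcₙ_rpowIntegrand₁₂ A hp
  refine ConvexOn.congr ?_ fun a ha ↦ (hμ a ha).2.symm
  refine integral_convexOn_of_integrand_ae (convex_Ici 0) ?_ fun a ha ↦ (hμ a ha).1
  filter_upwards [ae_restrict_mem measurableSet_Ioi] with t ht
  exact convexOn_cfcₙ_rpowIntegrand₁₂ ht

lemma convexOn_nnrpow_Icc_one_two {p : ℝ≥0} (hp : p ∈ Icc 1 2) :
    ConvexOn ℝ (Ici (0 : A)) (fun a ↦ a ^ p) := by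
  obtain rfl | hp₁ := hp.1.eq_or_lt
  · exact (convexOn_id (convex_Ici 0)).congr CFC.nnrpow_one_eqOn.symm
  obtain rfl | hp₂ := hp.2.eq_or_lt
  · refine (convexOn_star_mul_self.subset (subset_univ _) (convex_Ici 0)).congr fun a ha ↦ ?_
    simp only [CFC.nnrpow_two a ha, (IsSelfAdjoint.of_nonneg ha).star_eq]
  · exact convexOn_nnrpow_Ioo_one_two ⟨hp₁, hp₂⟩

end NonUnital

lemma convexOn_rpow_Icc_one_two {A : Type*} [CStarAlgebra A] [PartialOrder A] [StarOrderedRing A]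
    {p : ℝ} (hp : p ∈ Icc 1 2) : ConvexOn ℝ (Ici (0 : A)) (fun a ↦ a ^ p) := by
  lift p to ℝ≥0 using zero_le_one.trans hp.1
  simp_rw [← CFC.nnrpow_eq_rpow (zero_lt_one.trans_le (NNReal.one_le_coe.1 hp.1))]
  exact convexOn_nnrpow_Icc_one_two (by exact_mod_cast hp)

end OperatorConvexity

section HermiteHadamard

lemma intervalIntegral_segment {F : Type*} [NormedAddCommGroup F] [NormedSpace ℝ F]
    [CompleteSpace F] (u v : F) :
    ∫ t in (0 : ℝ)..1, (t • u + (1 - t) • v) = (1 / 2 : ℝ) • (u + v) := by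
  have hid : ∫ t in (0 : ℝ)..1, t = 1 / 2 := by norm_num [integral_id]
  have hsub : ∫ t in (0 : ℝ)..1, (1 - t) = 1 / 2 := by
    rw [intervalIntegral.integral_comp_sub_left (fun t ↦ t)]
    norm_num [integral_id]
  rw [intervalIntegral.integral_add (Continuous.intervalIntegrable (by fun_prop) _ _)
      (Continuous.intervalIntegrable (by fun_prop) _ _),
    intervalIntegral.integral_smul_const, intervalIntegral.integral_smul_const, hid, hsub, smul_add]

variable {E F : Type*} [AddCommGroup E] [Module ℝ E]
  [NormedAddCommGroup F] [NormedSpace ℝ F] [CompleteSpace F] [PartialOrder F]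
  [IsOrderedAddMonoid F] [IsOrderedModule ℝ F] [ClosedIciTopology F]
  {s : Set E} {f : E → F} {a b : E}

theorem map_midpoint_le_intervalIntegral_of_convexOn (hf : ConvexOn ℝ s f) (ha : a ∈ s) (hb : b ∈ s)
    (hint : IntervalIntegrable (fun t : ℝ ↦ f (t • a + (1 - t) • b)) volume 0 1) :
    f ((1 / 2 : ℝ) • (a + b)) ≤ ∫ t in (0 : ℝ)..1, f (t • a + (1 - t) • b) := by
  set g : ℝ → F := fun t ↦ f (t • a + (1 - t) • b)
  have hint' : IntervalIntegrable (fun t ↦ g (1 - t)) volume 0 1 := by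
    simpa using (hint.comp_sub_left 1).symm
  have hmid : ∀ t ∈ Ioc (0 : ℝ) 1, f ((1 / 2 : ℝ) • (a + b)) ≤ (1 / 2 : ℝ) • (g t + g (1 - t)) := by
    intro t ht
    have hseg : ∀ u ∈ Icc (0 : ℝ) 1, u • a + (1 - u) • b ∈ s := fun u hu ↦
      hf.1 ha hb hu.1 (sub_nonneg.2 hu.2) (add_sub_cancel _ _)
    have ht' : 1 - t ∈ Icc (0 : ℝ) 1 := ⟨sub_nonneg.2 ht.2, sub_le_self 1 ht.1.le⟩
    have hconv := hf.2 (hseg t ⟨ht.1.le, ht.2⟩) (hseg (1 - t) ht') one_half_pos.le one_half_pos.le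
      (add_halves 1)
    rw [← smul_add, ← smul_add] at hconv
    convert hconv using 2
    module
  calc f ((1 / 2 : ℝ) • (a + b))
      = ∫ _ in (0 : ℝ)..1, f ((1 / 2 : ℝ) • (a + b)) := by simp
    _ ≤ ∫ t in (0 : ℝ)..1, (1 / 2 : ℝ) • (g t + g (1 - t)) := by
      simp only [intervalIntegral.integral_of_le zero_le_one]
      exact setIntegral_mono_on (by simp) ((hint.add hint').smul _).1 measurableSet_Ioc hmid
    _ = (1 / 2 : ℝ) • ((∫ t in (0 : ℝ)..1, g t) + ∫ t in (0 : ℝ)..1, g (1 - t)) := by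
      rw [intervalIntegral.integral_smul, intervalIntegral.integral_add hint hint']
    _ = ∫ t in (0 : ℝ)..1, g t := by
      rw [intervalIntegral.integral_comp_sub_left g, sub_self, sub_zero, ← two_smul ℝ, smul_smul]
      norm_num

theorem intervalIntegral_le_midpoint_map_of_convexOn (hf : ConvexOn ℝ s f) (ha : a ∈ s) (hb : b ∈ s)
    (hint : IntervalIntegrable (fun t : ℝ ↦ f (t • a + (1 - t) • b)) volume 0 1) :
    ∫ t in (0 : ℝ)..1, f (t • a + (1 - t) • b) ≤ (1 / 2 : ℝ) • (f a + f b) := by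
  rw [← intervalIntegral_segment]
  simp only [intervalIntegral.integral_of_le zero_le_one]
  refine setIntegral_mono_on hint.1 (Continuous.intervalIntegrable (by fun_prop) 0 1).1
    measurableSet_Ioc fun t ht ↦ ?_
  exact hf.2 ha hb ht.1.le (sub_nonneg.2 ht.2) (add_sub_cancel _ _)

end HermiteHadamard

section RpowSegment

variable {A : Type*} [CStarAlgebra A] [PartialOrder A] [StarOrderedRing A] {a b : A} {p : ℝ}

lemma continuousOn_rpow_Ici (hp : 0 ≤ p) : ContinuousOn (fun a : A ↦ a ^ p) (Ici 0) :=
  continuousOn_id.cfc_nnreal_of_mem_nhdsSet _ Filter.univ_mem (fun _ ha ↦ ha)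
    (NNReal.continuous_rpow_const hp).continuousOn

lemma intervalIntegrable_segment_rpow (ha : 0 ≤ a) (hb : 0 ≤ b) (hp : 0 ≤ p) :
    IntervalIntegrable (fun t : ℝ ↦ (t • a + (1 - t) • b) ^ p) volume 0 1 := by
  refine ContinuousOn.intervalIntegrable_of_Icc zero_le_one ?_
  refine (continuousOn_rpow_Ici hp).comp (by fun_prop) fun t ht ↦ ?_
  exact convex_Ici (0 : A) ha hb ht.1 (sub_nonneg.2 ht.2) (add_sub_cancel _ _)

theorem norm_midpoint_le_norm_intervalIntegral_rpow (ha : 0 ≤ a) (hb : 0 ≤ b)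
    (hp : p ∈ Icc (1 : ℝ) 2) :
    ‖(1 / 2 : ℝ) • (a + b)‖ ≤ ‖∫ t in (0 : ℝ)..1, (t • a + (1 - t) • b) ^ p‖ ^ (1 / p) := by
  have hp₀ : 0 < p := zero_lt_one.trans_le hp.1
  have hmid : 0 ≤ (1 / 2 : ℝ) • (a + b) := smul_nonneg one_half_pos.le (add_nonneg ha hb)
  rw [one_div p, Real.le_rpow_inv_iff_of_pos (norm_nonneg _) (norm_nonneg _) hp₀,
    ← CFC.norm_rpow _ hp₀ hmid]
  exact CStarAlgebra.norm_le_norm_of_nonneg_of_le CFC.rpow_nonneg <|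
    map_midpoint_le_intervalIntegral_of_convexOn (convexOn_rpow_Icc_one_two hp) ha hb
      (intervalIntegrable_segment_rpow ha hb hp₀.le)

theorem norm_intervalIntegral_rpow_le_norm_midpoint (ha : 0 ≤ a) (hb : 0 ≤ b)
    (hp : p ∈ Icc (1 : ℝ) 2) :
    ‖∫ t in (0 : ℝ)..1, (t • a + (1 - t) • b) ^ p‖ ≤ ‖(1 / 2 : ℝ) • (a ^ p + b ^ p)‖ := by
  refine CStarAlgebra.norm_le_norm_of_nonneg_of_le ?_ <|
    intervalIntegral_le_midpoint_map_of_convexOn (convexOn_rpow_Icc_one_two hp) ha hb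
      (intervalIntegrable_segment_rpow ha hb (zero_le_one.trans hp.1))
  rw [intervalIntegral.integral_of_le zero_le_one]
  exact integral_nonneg fun _ ↦ CFC.rpow_nonneg

end RpowSegment

section NumericalRadius

lemma norm_apply_sq_add_norm_star_apply_sq_le {𝕜 H : Type*} [RCLike 𝕜] [NormedAddCommGroup H]
    [InnerProductSpace 𝕜 H] [CompleteSpace H] (T : H →L[𝕜] H) (x : H) :
    ‖T x‖ ^ 2 + ‖star T x‖ ^ 2 ≤ ‖star T * T + T * star T‖ * ‖x‖ ^ 2 := by
  have hT : ‖T x‖ ^ 2 = RCLike.re (inner 𝕜 ((star T * T) x) x) :=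
    T.apply_norm_sq_eq_inner_adjoint_left x
  have hT' : ‖star T x‖ ^ 2 = RCLike.re (inner 𝕜 ((T * star T) x) x) := by
    simpa [ContinuousLinearMap.star_eq_adjoint] using
      (star T).apply_norm_sq_eq_inner_adjoint_left x
  calc ‖T x‖ ^ 2 + ‖star T x‖ ^ 2
      = RCLike.re (inner 𝕜 ((star T * T + T * star T) x) x) := by
        rw [hT, hT', add_apply, inner_add_left, map_add]
    _ ≤ ‖(star T * T + T * star T) x‖ * ‖x‖ := re_inner_le_norm _ _
    _ ≤ ‖star T * T + T * star T‖ * ‖x‖ * ‖x‖ := by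
        gcongr
        exact ContinuousLinearMap.le_opNorm _ _
    _ = ‖star T * T + T * star T‖ * ‖x‖ ^ 2 := by ring

variable {H : Type*} [NormedAddCommGroup H] [InnerProductSpace ℂ H]

lemma numericalRadius_nonneg (T : H →L[ℂ] H) : 0 ≤ numericalRadius T :=
  Real.sSup_nonneg (by rintro _ ⟨x, -, rfl⟩; exact norm_nonneg _)

lemma numericalRadius_le {T : H →L[ℂ] H} {M : ℝ} (hM : 0 ≤ M)
    (h : ∀ x, ‖x‖ = 1 → ‖inner ℂ x (T x)‖ ≤ M) : numericalRadius T ≤ M :=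
  Real.sSup_le (by rintro _ ⟨x, hx, rfl⟩; exact h x hx) hM

theorem numericalRadius_sq_le [CompleteSpace H] (T : H →L[ℂ] H) :
    numericalRadius T ^ 2 ≤ 1 / 2 * ‖star T * T + T * star T‖ := by
  rw [← Real.le_sqrt (numericalRadius_nonneg T) (by positivity)]
  refine numericalRadius_le (Real.sqrt_nonneg _) fun x hx ↦ Real.le_sqrt_of_sq_le ?_
  have hT : ‖inner ℂ x (T x)‖ ≤ ‖T x‖ := by
    simpa [hx] using norm_inner_le_norm (𝕜 := ℂ) x (T x)
  have hT' : ‖inner ℂ x (T x)‖ ≤ ‖star T x‖ := by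
    rw [← ContinuousLinearMap.adjoint_inner_left, ← ContinuousLinearMap.star_eq_adjoint]
    simpa [hx] using norm_inner_le_norm (𝕜 := ℂ) (star T x) x
  calc ‖inner ℂ x (T x)‖ ^ 2
      = 1 / 2 * (‖inner ℂ x (T x)‖ ^ 2 + ‖inner ℂ x (T x)‖ ^ 2) := by ring
    _ ≤ 1 / 2 * (‖T x‖ ^ 2 + ‖star T x‖ ^ 2) := by gcongr
    _ ≤ 1 / 2 * ‖star T * T + T * star T‖ := by
        gcongr
        simpa [hx] using norm_apply_sq_add_norm_star_apply_sq_le T x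

end NumericalRadius

theorem corollary2p11 {H : Type*} [NormedAddCommGroup H] [InnerProductSpace ℂ H]
    [CompleteSpace H] (T : H →L[ℂ] H) (r : ℝ) (hr₁ : 1 ≤ r) (hr₂ : r ≤ 2) :
    IntervalIntegrable
      (fun t : ℝ => (t • (star T * T) + (1 - t) • (T * star T)) ^ r)
      MeasureTheory.volume 0 1 ∧
    numericalRadius T ^ 2 ≤
      ‖∫ t in (0 : ℝ)..1, (t • (star T * T) + (1 - t) • (T * star T)) ^ r‖ ^ (1 / r) ∧
    ‖∫ t in (0 : ℝ)..1, (t • (star T * T) + (1 - t) • (T * star T)) ^ r‖ ^ (1 / r) ≤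
      ‖(1 / 2 : ℝ) • ((star T * T) ^ r + (T * star T) ^ r)‖ ^ (1 / r) := by
  have ha : 0 ≤ star T * T := star_mul_self_nonneg T
  have hb : 0 ≤ T * star T := mul_star_self_nonneg T
  refine ⟨intervalIntegrable_segment_rpow ha hb (zero_le_one.trans hr₁), ?_, ?_⟩
  · calc numericalRadius T ^ 2 ≤ 1 / 2 * ‖star T * T + T * star T‖ := numericalRadius_sq_le T
      _ = ‖(1 / 2 : ℝ) • (star T * T + T * star T)‖ := by
        rw [norm_smul, Real.norm_of_nonneg one_half_pos.le]
      _ ≤ _ := norm_midpoint_le_norm_intervalIntegral_rpow ha hb ⟨hr₁, hr₂⟩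
  · gcongr
    exact norm_intervalIntegral_rpow_le_norm_midpoint ha hb ⟨hr₁, hr₂⟩
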